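/- Let $n\ge 1$. A convex body in $\mathbb R^n$ is a compact convex set $\Omega\subset\mathbb R^n$ with non-empty interior. Let $\mathrm{vol}(\Omega)$ be its $n$-dimensional Lebesgue measure, $\mathrm{per}(\Omega)$ the $(n-1)$-dimensional measure of its boundary $\partial\Omega$ (the Euclidean Hausdorff measure, normalised to agree with $(n-1)$-dimensional Lebesgue measure on hyperplanes), and $\mathrm{In}(\Omega)$ its inradius, the radius of the largest closed ball contained in $\Omega$. For every convex body $\Omega\subset\mathbb R^n$ the numbers $\mathrm{vol}(\Omega)$ and $\mathrm{per}(\Omega)$ are positive and finite, a largest inscribed ball exists, and $$\frac{\mathrm{vol}(\Omega)}{\mathrm{per}(\Omega)}\;\le\;\mathrm{In}(\Omega)\;\le\; n\,\frac{\mathrm{vol}(\Omega)}{\mathrm{per}(\Omega)}.$$ Moreover, for each $n$ the constants $1$ and $n$ cannot be improved: if $c\in\mathbb R$ satisfies $c\,\mathrm{vol}(\Omega)/\mathrm{per}(\Omega)\le \mathrm{In}(\Omega)$ for all convex bodies $\Omega\subset\mathbb R^n$, then $c\le 1$; and if $C\in\mathbb R$ satisfies $\mathrm{In}(\Omega)\le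 C\,\mathrm{vol}(\Omega)/\mathrm{per}(\Omega)$ for all convex bodies $\Omega\subset\mathbb R^n$, then $C\ge n$. Indeed, for $K\ge1$ let $\Omega_K=[0,1]\times[0,K]^{n-1}$, which is a convex body; then $\mathrm{In}(\Omega_1)=n\,\mathrm{vol}(\Omega_1)/\mathrm{per}(\Omega_1)$, and $$\frac{\mathrm{In}(\Omega_K)}{\mathrm{vol}(\Omega_K)/\mathrm{per}(\Omega_K)}\longrightarrow 1\qquad\text{as }K\to\infty.$$ -/

import Mathlib

open MeasureTheory Filter Topology

noncomputable section

namespace Heron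

/-- A convex body in `ℝⁿ`: a compact (closed and bounded) convex set with nonempty interior. -/
structure IsConvexBody {n : ℕ} (Ω : Set (EuclideanSpace ℝ (Fin n))) : Prop where
  convex : Convex ℝ Ω
  isCompact : IsCompact Ω
  nonempty_interior : (interior Ω).Nonempty

/-- The volume of `Ω ⊂ ℝⁿ`: its `n`-dimensional Lebesgue measure, as a real number
(`0` if the measure is infinite). -/
def vol {n : ℕ} (Ω : Set (EuclideanSpace ℝ (Fin n))) : ℝ :=
  (volume Ω).toReal

/-- The perimeter of `Ω ⊂ ℝⁿ`: the `(n-1)`-dimensional measure of its topological boundary, as a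
real number (`0` if the measure is infinite). Here `μHE[n - 1]` is the `(n-1)`-dimensional
Hausdorff measure for the Euclidean distance, normalised so that it agrees with
`(n-1)`-dimensional Lebesgue measure on hyperplanes. -/
def per {n : ℕ} (Ω : Set (EuclideanSpace ℝ (Fin n))) : ℝ :=
  (μHE[n - 1] (frontier Ω)).toReal

/-- The radii of the closed balls contained in `Ω` (points count as balls of radius `0`). -/
def inscribedRadii {n : ℕ} (Ω : Set (EuclideanSpace ℝ (Fin n))) : Set ℝ :=
  {r | 0 ≤ r ∧ ∃ x, Metric.closedBall x r ⊆ Ω}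

/-- The inradius of `Ω`: the radius of the largest ball inscribed in `Ω`. -/
def inradius {n : ℕ} (Ω : Set (EuclideanSpace ℝ (Fin n))) : ℝ :=
  sSup (inscribedRadii Ω)

/-- The box `[0,1] × [0,K]ⁿ⁻¹` in `ℝⁿ`. -/
def box (n : ℕ) (K : ℝ) : Set (EuclideanSpace ℝ (Fin n)) :=
  {x | ∀ i : Fin n, x i ∈ Set.Icc (0 : ℝ) (if (i : ℕ) = 0 then 1 else K)}

end Heron

end

/-! Both inequalities are proved for polytopes by decomposing along facets, then transferred by
approximation. Let the facets F_i lie on ⟨a_i, x⟩ = b_i with unit normals a_i. If all b_i > 0, the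
cones from 0 over the F_i are disjoint subsets of the polytope, of volume b_i|F_i|/n each. A ball of
radius r about 0 forces b_i ≥ r, hence r·per ≤ n·vol (`ofReal_mul_measure_frontier_polytope_le`).
Conversely, a point at distance d from the nearest facet hyperplane is the centre of an inscribed
ball of radius d, so slabs of depth R over the facets cover the polytope once R bounds all inscribed
radii, and vol ≤ R·per (`volume_polytope_le_of_inscribed_le`).

A convex body satisfies Ω ⊆ P ⊆ cΩ for a polytope P and any c > 1 (`exists_polytope_between`).
Perimeter is monotone on convex sets (`measure_frontier_mono`), so the inequalities pass to Ω up to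
a power of c, and c → 1.

For sharpness, the centred unit cube has all offsets equal to its inradius 1/2, so the cone argument
is an equality. For the long boxes the ratio is squeezed between 1 and the sum of the reciprocal
side lengths. -/

section

open scoped RealInnerProductSpace Pointwise ENNReal

namespace Heron

variable {n : ℕ} {ι : Type*}

/-! ### Volumes of cones and slabs by slicing. -/

/-- Fubini's theorem for the slices orthogonal to a unit vector. -/
theorem volume_eq_lintegral_slice {a : EuclideanSpace ℝ (Fin n)} (ha : ‖a‖ = 1)
    {t : Set (EuclideanSpace ℝ (Fin n))} (ht : MeasurableSet t) :
    volume t = ∫⁻ s : ℝ, μHE[n - 1] (t ∩ {x | ⟪a, x⟫ = s}) := by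
  have ha0 : a ≠ 0 := by rintro rfl; simp at ha
  have h := EuclideanGeometry.euclideanHausdorffMeasure_eq_lintegral
    (0 : EuclideanSpace ℝ (Fin n)) ha0 ht
  rw [InnerProductSpace.euclideanHausdorffMeasure_eq_volume, finrank_euclideanSpace_fin] at h
  have ha' : ‖a‖ₑ = 1 := by rw [← ofReal_norm, ha, ENNReal.ofReal_one]
  rw [h, ha', one_mul]
  congr! 4 with s
  ext x
  simp only [vadd_eq_add, add_zero, SetLike.mem_coe, AffineSubspace.mem_mk', vsub_eq_sub,
    Submodule.mem_orthogonal_singleton_iff_inner_right, Set.mem_ofPred_eq, inner_sub_right,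
    inner_smul_right, real_inner_self_eq_norm_sq, ha]
  constructor <;> intro h <;> linarith

/-- The cone with apex `0` (removed) over a subset `F` of the hyperplane `⟪a, x⟫ = b`. -/
def cone (a : EuclideanSpace ℝ (Fin n)) (b : ℝ) (F : Set (EuclideanSpace ℝ (Fin n))) :
    Set (EuclideanSpace ℝ (Fin n)) :=
  {x | 0 < ⟪a, x⟫ ∧ ⟪a, x⟫ ≤ b ∧ (b / ⟪a, x⟫) • x ∈ F}

/-- The points whose translate along `a` to the hyperplane `⟪a, x⟫ = b` lies in `F`, at depth
at most `r` under that hyperplane. -/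
def slab (a : EuclideanSpace ℝ (Fin n)) (b r : ℝ) (F : Set (EuclideanSpace ℝ (Fin n))) :
    Set (EuclideanSpace ℝ (Fin n)) :=
  {x | b - r ≤ ⟪a, x⟫ ∧ ⟪a, x⟫ ≤ b ∧ x + (b - ⟪a, x⟫) • a ∈ F}

theorem measurableSet_cone (a : EuclideanSpace ℝ (Fin n)) (b : ℝ)
    {F : Set (EuclideanSpace ℝ (Fin n))} (hF : MeasurableSet F) : MeasurableSet (cone a b F) := by
  have hm : Measurable fun x : EuclideanSpace ℝ (Fin n) => ⟪a, x⟫ := by fun_prop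
  have hg : Measurable fun x : EuclideanSpace ℝ (Fin n) => (b / ⟪a, x⟫) • x := by fun_prop
  exact (measurableSet_lt measurable_const hm).inter
    ((measurableSet_le hm measurable_const).inter (hg hF))

theorem measurableSet_slab (a : EuclideanSpace ℝ (Fin n)) (b r : ℝ)
    {F : Set (EuclideanSpace ℝ (Fin n))} (hF : MeasurableSet F) : MeasurableSet (slab a b r F) := by
  have hm : Measurable fun x : EuclideanSpace ℝ (Fin n) => ⟪a, x⟫ := by fun_prop
  have hg : Measurable fun x : EuclideanSpace ℝ (Fin n) => x + (b - ⟪a, x⟫) • a := by fun_prop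
  exact (measurableSet_le measurable_const hm).inter
    ((measurableSet_le hm measurable_const).inter (hg hF))

/-- The slice at height s is F scaled by s/b, and the integral of (s/b)^(n-1) over (0, b] is b/n. -/
theorem volume_cone (hn : 1 ≤ n) {a : EuclideanSpace ℝ (Fin n)} (ha : ‖a‖ = 1) {b : ℝ} (hb : 0 < b)
    {F : Set (EuclideanSpace ℝ (Fin n))} (hF : MeasurableSet F) (hFb : ∀ x ∈ F, ⟪a, x⟫ = b) :
    n * volume (cone a b F) = ENNReal.ofReal b * μHE[n - 1] F := by
  have key : ∀ s : ℝ, μHE[n - 1] (cone a b F ∩ {x | ⟪a, x⟫ = s}) =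
      (Set.Ioc 0 b).indicator (fun s => ENNReal.ofReal ((s / b) ^ (n - 1)) * μHE[n - 1] F) s := by
    intro s
    by_cases hs : s ∈ Set.Ioc 0 b
    · have hsb : 0 < s / b := div_pos hs.1 hb
      have : cone a b F ∩ {x | ⟪a, x⟫ = s} = (s / b) • F := by
        ext x
        rw [Set.mem_smul_set_iff_inv_smul_mem₀ hsb.ne', inv_div]
        constructor
        · rintro ⟨⟨-, -, h⟩, rfl⟩
          exact h
        · intro h
          have h1 := hFb _ h
          rw [inner_smul_right] at h1
          have h2 : ⟪a, x⟫ = s := by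
            have := hs.1.ne'
            field_simp at h1
            exact h1
          refine ⟨⟨?_, ?_, ?_⟩, h2⟩
          · rw [h2]; exact hs.1
          · rw [h2]; exact hs.2
          · rw [h2]; exact h
      rw [Set.indicator_of_mem hs, this, Measure.euclideanHausdorffMeasure_smul₀ _ hsb.ne',
        ENNReal.smul_def, smul_eq_mul, ENNReal.ofReal_pow hsb.le, ENNReal.coe_pow]
      congr 2
      rw [Real.nnnorm_of_nonneg hsb.le, ENNReal.ofReal, Real.toNNReal_of_nonneg hsb.le]
    · rw [Set.indicator_of_notMem hs]
      convert measure_empty (μ := μHE[n - 1])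
      rw [Set.eq_empty_iff_forall_notMem]
      rintro x ⟨⟨h1, h2, -⟩, rfl⟩
      exact hs ⟨h1, h2⟩
  rw [volume_eq_lintegral_slice ha (measurableSet_cone a b hF)]
  simp_rw [key]
  rw [lintegral_indicator measurableSet_Ioc, lintegral_mul_const _ (by fun_prop), ← mul_assoc]
  congr 1
  have hint : IntegrableOn (fun s : ℝ => (s / b) ^ (n - 1)) (Set.Ioc 0 b) :=
    (by fun_prop : Continuous fun s : ℝ => (s / b) ^ (n - 1)).integrableOn_Ioc
  rw [← ofReal_integral_eq_lintegral_ofReal hint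
    ((ae_restrict_iff' measurableSet_Ioc).2 (ae_of_all _ fun s hs =>
      pow_nonneg (div_nonneg hs.1.le hb.le) _)), ← intervalIntegral.integral_of_le hb.le,
    ← ENNReal.ofReal_natCast, ← ENNReal.ofReal_mul (Nat.cast_nonneg _)]
  congr 1
  have hn' : ((n - 1 : ℕ) : ℝ) + 1 = n := by
    rw [← Nat.cast_succ]; congr 1; omega
  have hn0 : (n : ℝ) ≠ 0 := by positivity
  rw [intervalIntegral.integral_comp_div (fun s => s ^ (n - 1)) hb.ne', integral_pow, hn',
    div_self hb.ne', Nat.sub_add_cancel hn]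
  simp only [zero_div, one_pow, smul_eq_mul]
  rw [zero_pow (by omega)]
  field_simp
  ring

theorem volume_slab {a : EuclideanSpace ℝ (Fin n)} (ha : ‖a‖ = 1) (b r : ℝ)
    {F : Set (EuclideanSpace ℝ (Fin n))} (hF : MeasurableSet F) (hFb : ∀ x ∈ F, ⟪a, x⟫ = b) :
    volume (slab a b r F) = ENNReal.ofReal r * μHE[n - 1] F := by
  have key : ∀ s : ℝ, μHE[n - 1] (slab a b r F ∩ {x | ⟪a, x⟫ = s}) =
      (Set.Icc (b - r) b).indicator (fun _ => μHE[n - 1] F) s := by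
    intro s
    by_cases hs : s ∈ Set.Icc (b - r) b
    · have : slab a b r F ∩ {x | ⟪a, x⟫ = s} = (fun x => x + (b - s) • a) ⁻¹' F := by
        ext x
        constructor
        · rintro ⟨⟨-, -, h⟩, rfl⟩
          exact h
        · intro h
          have h1 := hFb _ h
          rw [inner_add_right, inner_smul_right, real_inner_self_eq_norm_sq, ha] at h1
          have h2 : ⟪a, x⟫ = s := by linarith
          refine ⟨⟨?_, ?_, ?_⟩, h2⟩
          · rw [h2]; exact hs.1
          · rw [h2]; exact hs.2
          · rw [h2]; exact h
      rw [Set.indicator_of_mem hs, this, measure_preimage_add_right]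
    · rw [Set.indicator_of_notMem hs]
      convert measure_empty (μ := μHE[n - 1])
      rw [Set.eq_empty_iff_forall_notMem]
      rintro x ⟨⟨h1, h2, -⟩, rfl⟩
      exact hs ⟨h1, h2⟩
  rw [volume_eq_lintegral_slice ha (measurableSet_slab a b r hF)]
  simp_rw [key]
  rw [lintegral_indicator measurableSet_Icc, setLIntegral_const, Real.volume_Icc, mul_comm,
    sub_sub_cancel]

/-! ### Polytopes and their facets. -/

/-- The intersection of the half-spaces `⟪a i, x⟫ ≤ b i`. -/
def polytope (a : ι → EuclideanSpace ℝ (Fin n)) (b : ι → ℝ) : Set (EuclideanSpace ℝ (Fin n)) :=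
  {x | ∀ i, ⟪a i, x⟫ ≤ b i}

/-- The points of the `i`-th facet of a polytope that lie on no facet of smaller index. -/
def facet [LT ι] (a : ι → EuclideanSpace ℝ (Fin n)) (b : ι → ℝ) (i : ι) :
    Set (EuclideanSpace ℝ (Fin n)) :=
  {x | x ∈ polytope a b ∧ ⟪a i, x⟫ = b i ∧ ∀ j < i, ⟪a j, x⟫ < b j}

variable {a : ι → EuclideanSpace ℝ (Fin n)} {b : ι → ℝ}

theorem isClosed_polytope : IsClosed (polytope a b) := by
  rw [polytope, Set.ofPred_forall]
  exact isClosed_iInter fun i => isClosed_le (by fun_prop) (by fun_prop)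

theorem convex_polytope : Convex ℝ (polytope a b) := by
  intro x hx y hy s t hs ht hst i
  rw [inner_add_right, inner_smul_right, inner_smul_right]
  calc s * ⟪a i, x⟫ + t * ⟪a i, y⟫ ≤ s * b i + t * b i := by
        gcongr
        · exact hx i
        · exact hy i
    _ = b i := by rw [← add_mul, hst, one_mul]

theorem frontier_polytope [Finite ι] (ha : ∀ i, ‖a i‖ = 1) :
    frontier (polytope a b) = {x | x ∈ polytope a b ∧ ∃ i, ⟪a i, x⟫ = b i} := by
  rw [isClosed_polytope.frontier_eq]
  ext x
  refine and_congr_right fun hx => ?_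
  constructor
  · intro h
    by_contra! hne
    refine h (mem_interior.2 ⟨{x | ∀ i, ⟪a i, x⟫ < b i}, fun y hy i => (hy i).le, ?_,
      fun i => (hx i).lt_of_ne (hne i)⟩)
    rw [Set.ofPred_forall]
    exact isOpen_iInter_of_finite fun i => isOpen_lt (by fun_prop) (by fun_prop)
  · rintro ⟨i, hi⟩ hint
    obtain ⟨ε, hε, hball⟩ := Metric.mem_nhds_iff.1 (mem_interior_iff_mem_nhds.1 hint)
    have h : x + (ε / 2) • a i ∈ polytope a b := by
      apply hball
      rw [mem_ball_iff_norm, add_sub_cancel_left, norm_smul, ha, mul_one, Real.norm_of_nonneg] <;>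
        linarith
    have h1 := h i
    rw [inner_add_right, inner_smul_right, real_inner_self_eq_norm_sq, ha, hi] at h1
    linarith

theorem measurableSet_facet [LinearOrder ι] [Countable ι] (i : ι) :
    MeasurableSet (facet a b i) := by
  refine isClosed_polytope.measurableSet.inter
    ((isClosed_eq (by fun_prop) (by fun_prop)).measurableSet.inter ?_)
  change MeasurableSet {x | ∀ j, j < i → ⟪a j, x⟫ < b j}
  simp only [Set.ofPred_forall]
  exact MeasurableSet.iInter fun j => MeasurableSet.iInter fun _ =>
    (isOpen_lt (by fun_prop) (by fun_prop)).measurableSet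

theorem facet_index_unique [LinearOrder ι] {i j : ι} {x : EuclideanSpace ℝ (Fin n)}
    (hi : x ∈ facet a b i) (hj : x ∈ facet a b j) : i = j := by
  by_contra h
  rcases lt_or_gt_of_ne h with h | h
  · exact (hj.2.2 i h).ne hi.2.1
  · exact (hi.2.2 j h).ne hj.2.1

theorem exists_mem_facet [LinearOrder ι] [Finite ι] {i : ι} {x : EuclideanSpace ℝ (Fin n)}
    (hx : x ∈ polytope a b) (hi : ⟪a i, x⟫ = b i) : ∃ j, x ∈ facet a b j := by
  obtain ⟨j, hj, hmin⟩ := WellFounded.has_min (r := (· < · : ι → ι → Prop))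
    (Finite.to_wellFoundedLT).wf {j | ⟪a j, x⟫ = b j} ⟨i, hi⟩
  exact ⟨j, hx, hj, fun k hk => (hx k).lt_of_ne fun h => hmin k h hk⟩

/-- Assigning each boundary point to its facet of least index makes the pieces disjoint, so the sum
is exact without showing that facets overlap in null sets. -/
theorem measure_frontier_polytope [LinearOrder ι] [Fintype ι] (ha : ∀ i, ‖a i‖ = 1)
    (μ : Measure (EuclideanSpace ℝ (Fin n))) :
    μ (frontier (polytope a b)) = ∑ i, μ (facet a b i) := by
  have : frontier (polytope a b) = ⋃ i, facet a b i := by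
    rw [frontier_polytope ha]
    ext x
    simp only [Set.mem_iUnion]
    constructor
    · rintro ⟨hx, i, hi⟩
      exact exists_mem_facet hx hi
    · rintro ⟨i, hi⟩
      exact ⟨hi.1, i, hi.2.1⟩
  rw [this, measure_iUnion, tsum_fintype]
  · intro i j hij
    exact Set.disjoint_left.2 fun x hi hj => hij (facet_index_unique hi hj)
  · exact measurableSet_facet

/-! ### The inequalities for polytopes. -/

theorem ofReal_mul_measure_frontier_polytope_le [Fintype ι] (hn : 1 ≤ n) (ha : ∀ i, ‖a i‖ = 1)
    {r : ℝ} (hr : 0 < r) (hrb : ∀ i, r ≤ b i) :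
    ENNReal.ofReal r * μHE[n - 1] (frontier (polytope a b)) ≤ n * volume (polytope a b) := by
  -- An arbitrary order, used only to break ties between facets.
  let _ : LinearOrder ι := LinearOrder.lift' (Fintype.equivFin ι) (Fintype.equivFin ι).injective
  have hb i : 0 < b i := hr.trans_le (hrb i)
  rw [measure_frontier_polytope ha, Finset.mul_sum]
  have hdisj : Pairwise (Function.onFun Disjoint fun i => cone (a i) (b i) (facet a b i)) := by
    intro i j hij
    refine Set.disjoint_left.2 ?_
    rintro x ⟨hi0, -, hi⟩ ⟨hj0, -, hj⟩
    -- The ray through x leaves the polytope at the multiple b k / ⟪a k, x⟫. Two cones containing x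
    -- therefore share the exit point, which belongs to only one facet.
    have hle {k l : ι} (hk0 : 0 < ⟪a k, x⟫) (hl0 : 0 < ⟪a l, x⟫)
        (hk : (b k / ⟪a k, x⟫) • x ∈ facet a b k) : b k / ⟪a k, x⟫ ≤ b l / ⟪a l, x⟫ := by
      have := hk.1 l
      rw [inner_smul_right] at this
      rwa [le_div_iff₀ hl0]
    rw [le_antisymm (hle hj0 hi0 hj) (hle hi0 hj0 hi)] at hj
    exact hij (facet_index_unique hi hj)
  have hsub : (⋃ i, cone (a i) (b i) (facet a b i)) ⊆ polytope a b := by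
    rw [Set.iUnion_subset_iff]
    rintro i x ⟨h0, h1, hx⟩ j
    have h2 := hx.1 j
    rw [inner_smul_right, div_mul_eq_mul_div, div_le_iff₀ h0] at h2
    have : b i * ⟪a j, x⟫ ≤ b i * b j := h2.trans (by nlinarith [hb j])
    exact le_of_mul_le_mul_left this (hb i)
  calc ∑ i, ENNReal.ofReal r * μHE[n - 1] (facet a b i)
      ≤ ∑ i, ENNReal.ofReal (b i) * μHE[n - 1] (facet a b i) := by
        gcongr with i
        exact hrb i
    _ = n * volume (⋃ i, cone (a i) (b i) (facet a b i)) := by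
        rw [measure_iUnion hdisj fun i => measurableSet_cone _ _ (measurableSet_facet i),
          tsum_fintype, Finset.mul_sum]
        exact Finset.sum_congr rfl fun i _ =>
          (volume_cone hn (ha i) (hb i) (measurableSet_facet i) fun x hx => hx.2.1).symm
    _ ≤ n * volume (polytope a b) := by gcongr

/-- Here the cones must cover: by `hbdd` every ray from 0 leaves the polytope, and the apex is null.
This supplies the equality case for the cube. -/
theorem volume_polytope_le_of_offset_le [Fintype ι] (hn : 1 ≤ n) (ha : ∀ i, ‖a i‖ = 1)
    (hb : ∀ i, 0 < b i) (hbdd : ∀ x ≠ 0, ∃ i, 0 < ⟪a i, x⟫) {R : ℝ} (hbR : ∀ i, b i ≤ R) :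
    n * volume (polytope a b) ≤ ENNReal.ofReal R * μHE[n - 1] (frontier (polytope a b)) := by
  let _ : LinearOrder ι := LinearOrder.lift' (Fintype.equivFin ι) (Fintype.equivFin ι).injective
  have : Nonempty (Fin n) := ⟨⟨0, hn⟩⟩
  rw [measure_frontier_polytope ha, Finset.mul_sum]
  have hsub : polytope a b ⊆ {0} ∪ ⋃ i, cone (a i) (b i) (facet a b i) := by
    intro x hx
    by_cases hx0 : x = 0
    · exact Or.inl hx0
    right
    obtain ⟨k, hk⟩ := hbdd x hx0
    -- The constraint with the largest ratio is the first one that the ray through x meets.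
    obtain ⟨i, -, hi⟩ := Finset.exists_max_image Finset.univ (fun i => ⟪a i, x⟫ / b i)
      ⟨k, Finset.mem_univ k⟩
    have hi0 : 0 < ⟪a i, x⟫ :=
      (div_pos_iff_of_pos_right (hb i)).1 ((div_pos hk (hb k)).trans_le (hi k (Finset.mem_univ k)))
    have hmem : (b i / ⟪a i, x⟫) • x ∈ polytope a b := by
      intro j
      have h := hi j (Finset.mem_univ j)
      rw [div_le_div_iff₀ (hb j) (hb i)] at h
      rw [inner_smul_right, div_mul_eq_mul_div, div_le_iff₀ hi0]
      linarith
    have hbi : ⟪a i, (b i / ⟪a i, x⟫) • x⟫ = b i := by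
      rw [inner_smul_right, div_mul_cancel₀ _ hi0.ne']
    obtain ⟨j, hj⟩ := exists_mem_facet hmem hbi
    have hj1 := hj.2.1
    rw [inner_smul_right, div_mul_eq_mul_div, div_eq_iff hi0.ne'] at hj1
    have hj0 : 0 < ⟪a j, x⟫ := pos_of_mul_pos_right (hj1 ▸ mul_pos (hb j) hi0) (hb i).le
    refine Set.mem_iUnion.2 ⟨j, hj0, hx j, ?_⟩
    rwa [show b j / ⟪a j, x⟫ = b i / ⟪a i, x⟫ by
      rw [div_eq_div_iff hj0.ne' hi0.ne']; exact hj1.symm]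
  calc n * volume (polytope a b)
      ≤ n * ∑ i, volume (cone (a i) (b i) (facet a b i)) := by
        gcongr
        refine (measure_mono hsub).trans ((measure_union_le _ _).trans ?_)
        rw [measure_singleton, zero_add]
        exact measure_iUnion_fintype_le _ _
    _ = ∑ i, ENNReal.ofReal (b i) * μHE[n - 1] (facet a b i) := by
        rw [Finset.mul_sum]
        exact Finset.sum_congr rfl fun i _ =>
          volume_cone hn (ha i) (hb i) (measurableSet_facet i) fun x hx => hx.2.1
    _ ≤ ∑ i, ENNReal.ofReal R * μHE[n - 1] (facet a b i) := by
        gcongr with i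
        exact hbR i

theorem volume_polytope_le_of_inscribed_le [Fintype ι] [Nonempty ι] (ha : ∀ i, ‖a i‖ = 1)
    {R : ℝ} (hR : ∀ x s, 0 ≤ s → Metric.closedBall x s ⊆ polytope a b → s ≤ R) :
    volume (polytope a b) ≤ ENNReal.ofReal R * μHE[n - 1] (frontier (polytope a b)) := by
  let _ : LinearOrder ι := LinearOrder.lift' (Fintype.equivFin ι) (Fintype.equivFin ι).injective
  rw [measure_frontier_polytope ha, Finset.mul_sum]
  have hsub : polytope a b ⊆ ⋃ i, slab (a i) (b i) R (facet a b i) := by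
    intro x hx
    -- The nearest bounding hyperplane, at distance d: the ball of radius d about x stays inside, so
    -- d ≤ R, and the foot of the perpendicular lies on the boundary.
    obtain ⟨i, -, hi⟩ := Finset.exists_min_image Finset.univ (fun i => b i - ⟪a i, x⟫)
      Finset.univ_nonempty
    obtain ⟨d, hd⟩ : ∃ d, d = b i - ⟪a i, x⟫ := ⟨_, rfl⟩
    have hd0 : 0 ≤ d := by rw [hd]; exact sub_nonneg.2 (hx i)
    have hball : Metric.closedBall x d ⊆ polytope a b := by
      intro y hy j
      rw [mem_closedBall_iff_norm] at hy
      have h1 : ⟪a j, y - x⟫ ≤ d :=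
        (real_inner_le_norm _ _).trans (by rwa [ha, one_mul])
      rw [inner_sub_right] at h1
      have := hi j (Finset.mem_univ j)
      linarith
    have hy : x + d • a i ∈ polytope a b := by
      apply hball
      rw [mem_closedBall_iff_norm, add_sub_cancel_left, norm_smul, ha, mul_one,
        Real.norm_of_nonneg hd0]
    have hyi : ⟪a i, x + d • a i⟫ = b i := by
      rw [inner_add_right, inner_smul_right, real_inner_self_eq_norm_sq, ha, hd]
      ring
    obtain ⟨j, hj⟩ := exists_mem_facet hy hyi
    have hj1 := hj.2.1
    rw [inner_add_right, inner_smul_right] at hj1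
    have hij := hi j (Finset.mem_univ j)
    have hle : ⟪a j, a i⟫ ≤ 1 := (real_inner_le_norm _ _).trans (by rw [ha, ha, one_mul])
    -- Tie-breaking may assign the foot to another facet j. Since hyperplane j is no closer than d,
    -- this forces ⟪a j, a i⟫ = 1 when d > 0, so the normals agree.
    have heq : d • a j = d • a i ∧ b j - ⟪a j, x⟫ = d := by
      rcases hd0.eq_or_lt with h0 | h0
      · rw [← h0, zero_smul, zero_smul]
        exact ⟨rfl, by rw [← hj1, ← h0]; ring⟩
      · have h1 : ⟪a j, a i⟫ = 1 := by
          refine le_antisymm hle (le_of_mul_le_mul_left ?_ h0)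
          linarith
        rw [h1] at hj1
        exact ⟨by rw [(inner_eq_one_iff_of_norm_eq_one (ha j) (ha i)).1 h1], by linarith⟩
    have hdR := hR x d hd0 hball
    refine Set.mem_iUnion.2 ⟨j, by linarith [heq.2], hx j, ?_⟩
    rw [heq.2, heq.1]
    exact hj
  calc volume (polytope a b)
      ≤ ∑ i, volume (slab (a i) (b i) R (facet a b i)) :=
        (measure_mono hsub).trans (measure_iUnion_fintype_le _ _)
    _ = ∑ i, ENNReal.ofReal R * μHE[n - 1] (facet a b i) :=
        Finset.sum_congr rfl fun i _ =>
          volume_slab (ha i) (b i) R (measurableSet_facet i) fun x hx => hx.2.1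

/-! ### Outer normals and monotonicity of the perimeter. -/

theorem _root_.IsPreconnected.inter_frontier_nonempty {X : Type*} [TopologicalSpace X]
    {t s : Set X} (ht : IsPreconnected t) (h1 : (t ∩ s).Nonempty) (h2 : (t ∩ sᶜ).Nonempty) :
    (t ∩ frontier s).Nonempty := by
  by_contra hne
  have hint {x : X} (hx : x ∈ t) (hc : x ∈ closure s) : x ∈ interior s := by
    by_contra hi
    exact hne ⟨x, hx, hc, hi⟩
  obtain ⟨x, hx, hxs⟩ := h1
  obtain ⟨y, hy, hys⟩ := h2
  obtain ⟨z, -, hz1, hz2⟩ := ht (interior s) (closure s)ᶜ isOpen_interior isClosed_closure.isOpen_compl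
    (fun w hw => or_iff_not_imp_right.2 fun hc => hint hw (not_not.1 hc))
    ⟨x, hx, hint hx (subset_closure hxs)⟩
    ⟨y, hy, fun hc => hys (interior_subset (hint hy hc))⟩
  exact hz2 (interior_subset_closure hz1)

theorem exists_unit_outer_normal {Ω : Set (EuclideanSpace ℝ (Fin n))} (hΩ : Convex ℝ Ω)
    (hne : (interior Ω).Nonempty) {y : EuclideanSpace ℝ (Fin n)} (hy : y ∈ frontier Ω) :
    ∃ u : EuclideanSpace ℝ (Fin n), ‖u‖ = 1 ∧ ∀ z ∈ Ω, ⟪u, z⟫ ≤ ⟪u, y⟫ := by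
  obtain ⟨f, hf0, hf⟩ := geometric_hahn_banach_of_nonempty_interior_point hΩ hy.2 hne
  set v := (InnerProductSpace.toDual ℝ (EuclideanSpace ℝ (Fin n))).symm f
  have hv0 : v ≠ 0 := by simpa [v] using hf0
  have hv z : f z = ⟪v, z⟫ := (InnerProductSpace.toDual_symm_apply).symm
  refine ⟨‖v‖⁻¹ • v, by rw [norm_smul, norm_inv, norm_norm, inv_mul_cancel₀ (norm_ne_zero_iff.2 hv0)], fun z hz => ?_⟩
  rw [real_inner_smul_left, real_inner_smul_left, ← hv, ← hv]
  gcongr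
  exact hf z hz

/-- The perimeter is monotone under inclusion of convex sets. -/
theorem measure_frontier_mono {Ω Ω' : Set (EuclideanSpace ℝ (Fin n))} (hΩ : Convex ℝ Ω)
    (hne : (interior Ω).Nonempty) (hsub : Ω ⊆ Ω') (hcl : IsClosed Ω')
    (hbdd : Bornology.IsBounded Ω') (d : ℕ) :
    μHE[d] (frontier Ω) ≤ μHE[d] (frontier Ω') := by
  -- Each boundary point is pushed along an outer normal until it reaches the outer boundary.
  have hex : ∀ x : frontier Ω, ∃ u : EuclideanSpace ℝ (Fin n), ∃ t : ℝ, 0 ≤ t ∧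
      (∀ z ∈ frontier Ω, ⟪u, z⟫ ≤ ⟪u, (x : EuclideanSpace ℝ (Fin n))⟫) ∧
      (x : EuclideanSpace ℝ (Fin n)) + t • u ∈ frontier Ω' := by
    rintro ⟨x, hx⟩
    obtain ⟨u, hu, hle⟩ := exists_unit_outer_normal hΩ hne hx
    obtain ⟨C, hC⟩ := hbdd.exists_norm_le
    set ray := (fun t : ℝ => x + t • u) '' Set.Ici 0
    have hray : IsPreconnected ray :=
      isPreconnected_Ici.image _ (by fun_prop : Continuous fun t : ℝ => x + t • u).continuousOn
    have hxΩ' : x ∈ Ω' := closure_minimal hsub hcl hx.1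
    have h1 : (ray ∩ Ω').Nonempty := ⟨x, ⟨0, le_refl (0 : ℝ), by simp⟩, hxΩ'⟩
    have h2 : (ray ∩ Ω'ᶜ).Nonempty := by
      have hC0 : 0 ≤ C := (norm_nonneg x).trans (hC x hxΩ')
      refine ⟨x + (C + ‖x‖ + 1) • u, ⟨C + ‖x‖ + 1, by simp only [Set.mem_Ici]; positivity, rfl⟩,
        fun hmem => ?_⟩
      have h3 := hC _ hmem
      have h4 : ‖(C + ‖x‖ + 1) • u‖ = C + ‖x‖ + 1 := by
        rw [norm_smul, hu, mul_one, Real.norm_of_nonneg (by positivity)]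
      have h5 := norm_sub_le (x + (C + ‖x‖ + 1) • u) x
      rw [add_sub_cancel_left, h4] at h5
      linarith
    obtain ⟨-, ⟨t, ht, rfl⟩, hfr⟩ := hray.inter_frontier_nonempty h1 h2
    refine ⟨u, t, ht, fun z hz => ?_, hfr⟩
    exact closure_minimal (t := {z | ⟪u, z⟫ ≤ ⟪u, x⟫}) hle
      (isClosed_le (by fun_prop) (by fun_prop)) hz.1
  choose u t ht hu hfr using hex
  set g : frontier Ω → EuclideanSpace ℝ (Fin n) := fun x => x + t x • u x
  -- Pushing outwards never decreases distances: by the supporting inequalities at both points, the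
  -- difference of displacements has nonnegative inner product with p - q. No continuity of the
  -- choice is needed.
  have hg : AntilipschitzWith 1 g := by
    refine AntilipschitzWith.of_le_mul_dist fun x y => ?_
    rw [NNReal.coe_one, one_mul, Subtype.dist_eq, dist_eq_norm, dist_eq_norm]
    set p : EuclideanSpace ℝ (Fin n) := x.1
    set q : EuclideanSpace ℝ (Fin n) := y.1
    have h1 : ‖p - q‖ * ‖p - q‖ ≤ ‖g x - g y‖ * ‖p - q‖ := by
      refine le_trans ?_ (real_inner_le_norm (g x - g y) (p - q))
      have hx := mul_nonneg (ht x) (sub_nonneg.2 (hu x q y.2))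
      have hy := mul_nonneg (ht y) (sub_nonneg.2 (hu y p x.2))
      have : g x - g y = (p - q) + (t x • u x - t y • u y) := by simp only [g]; abel
      rw [this, inner_add_left, real_inner_self_eq_norm_mul_norm, inner_sub_left,
        real_inner_smul_left, real_inner_smul_left, inner_sub_right, inner_sub_right]
      linarith
    rcases (norm_nonneg (p - q)).eq_or_lt with h0 | h0
    · rw [← h0]; positivity
    · exact le_of_mul_le_mul_right h1 h0
  have h := hg.le_hausdorffMeasure_image (Nat.cast_nonneg d) Set.univ
  rw [ENNReal.coe_one, ENNReal.one_rpow, one_mul] at h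
  have hcoe := (isometry_subtype_coe (s := frontier Ω)).hausdorffMeasure_image
    (Or.inl (Nat.cast_nonneg d)) Set.univ
  rw [Set.image_univ, Subtype.range_coe] at hcoe
  rw [Measure.euclideanHausdorffMeasure_def, Measure.smul_apply, Measure.smul_apply, hcoe]
  gcongr
  refine h.trans (measure_mono ?_)
  rintro - ⟨x, -, rfl⟩
  exact hfr x

/-! ### Approximation by polytopes and passage to convex bodies. -/

/-- A convex body can be sandwiched between a polytope and its dilation by `c > 1`. -/
theorem exists_polytope_between {Ω : Set (EuclideanSpace ℝ (Fin n))} (hΩ : IsConvexBody Ω)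
    (h0 : 0 ∈ interior Ω) {c : ℝ} (hc : 1 < c) :
    ∃ (t : Finset (EuclideanSpace ℝ (Fin n))) (a : t → EuclideanSpace ℝ (Fin n)) (b : t → ℝ),
      (∀ i, ‖a i‖ = 1) ∧ Ω ⊆ polytope a b ∧ polytope a b ⊆ c • Ω := by
  have hc0 : 0 < c := one_pos.trans hc
  choose! u hu hle using fun y (hy : y ∈ frontier Ω) =>
    exists_unit_outer_normal hΩ.convex hΩ.nonempty_interior hy
  obtain ⟨ρ, hρ, hball⟩ := Metric.mem_nhds_iff.1 (mem_interior_iff_mem_nhds.1 h0)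
  have hpos : ∀ y ∈ frontier Ω, 0 < ⟪u y, y⟫ := by
    intro y hy
    have hmem : (ρ / 2) • u y ∈ Ω := by
      apply hball
      rw [mem_ball_zero_iff, norm_smul, hu y hy, mul_one, Real.norm_of_nonneg] <;> linarith
    have h1 := hle y hy _ hmem
    rw [inner_smul_right, real_inner_self_eq_norm_sq, hu y hy] at h1
    linarith
  have hcpt : IsCompact (frontier Ω) :=
    hΩ.isCompact.of_isClosed_subset isClosed_frontier hΩ.isCompact.isClosed.frontier_subset
  -- The neighbourhood of y consists of the z for which c • z violates the supporting inequality at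
  -- y. Finitely many such half-spaces cut off all of c • frontier Ω.
  obtain ⟨t, htsub, hcover⟩ := hcpt.elim_nhds_subcover (fun y => {z | ⟪u y, y⟫ < c * ⟪u y, z⟫})
    (fun y hy => (isOpen_lt (by fun_prop) (by fun_prop)).mem_nhds
      (by simpa using lt_mul_of_one_lt_left (hpos y hy) hc))
  refine ⟨t, fun y => u y, fun y => ⟪u y, (y : EuclideanSpace ℝ (Fin n))⟫,
    fun y => hu y (htsub y y.2), fun z hz y => hle y (htsub y y.2) z hz, fun p hp => ?_⟩
  rw [Set.mem_smul_set_iff_inv_smul_mem₀ hc0.ne']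
  by_contra hq
  -- If p / c were outside Ω, the segment from 0 to it would cross the boundary at z = s • c⁻¹ • p
  -- with s ≤ 1. Then c • z = s • p violates a chosen constraint that both 0 and p satisfy.
  obtain ⟨z, hz, hzfr⟩ := (convex_segment (𝕜 := ℝ) 0 (c⁻¹ • p)).isPreconnected.inter_frontier_nonempty
    ⟨0, left_mem_segment ℝ _ _, interior_subset h0⟩ ⟨c⁻¹ • p, right_mem_segment ℝ _ _, hq⟩
  obtain ⟨s, hs0, hs1, rfl⟩ : ∃ s : ℝ, 0 ≤ s ∧ s ≤ 1 ∧ s • c⁻¹ • p = z := by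
    rw [segment_eq_image] at hz
    obtain ⟨s, hs, rfl⟩ := hz
    exact ⟨s, hs.1, hs.2, by simp⟩
  obtain ⟨y, hy, hyz⟩ := Set.mem_iUnion₂.1 (hcover hzfr)
  have h1 : ⟪u y, p⟫ ≤ ⟪u y, y⟫ := hp ⟨y, hy⟩
  have h2 := hpos y (htsub y hy)
  have h3 : ⟪u y, y⟫ < c * (s * (c⁻¹ * ⟪u y, p⟫)) := by
    have h : ⟪u y, y⟫ < c * ⟪u y, s • c⁻¹ • p⟫ := hyz
    rwa [inner_smul_right, inner_smul_right] at h
  have h4 : c * (s * (c⁻¹ * ⟪u y, p⟫)) = s * ⟪u y, p⟫ := by field_simp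
  nlinarith

/-- The limit factor 1 is nonzero, so y = ∞ is allowed; finiteness of the perimeter need not be
known beforehand. -/
theorem le_of_forall_le_ofReal_pow_mul {x y : ℝ≥0∞} (k : ℕ)
    (h : ∀ c : ℝ, 1 < c → x ≤ ENNReal.ofReal (c ^ k) * y) : x ≤ y := by
  have hlim : Tendsto (fun c : ℝ => ENNReal.ofReal (c ^ k) * y) (𝓝[>] 1)
      (𝓝 (ENNReal.ofReal (1 ^ k) * y)) := by
    refine ENNReal.Tendsto.mul_const (ENNReal.tendsto_ofReal ?_) (Or.inl (by simp))
    exact ((continuous_pow k).tendsto 1).mono_left nhdsWithin_le_nhds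
  rw [one_pow, ENNReal.ofReal_one, one_mul] at hlim
  exact ge_of_tendsto hlim (eventually_mem_nhdsWithin.mono fun c hc => h c hc)

theorem _root_.frontier_smul₀ {c : ℝ} (hc : c ≠ 0) (s : Set (EuclideanSpace ℝ (Fin n))) :
    frontier (c • s) = c • frontier s := by
  rw [frontier, frontier, closure_smul₀' hc, interior_smul₀ hc, Set.smul_set_sdiff₀ hc]

theorem volume_smul_set {c : ℝ} (hc : 0 < c) (s : Set (EuclideanSpace ℝ (Fin n))) :
    volume (c • s) = ENNReal.ofReal (c ^ n) * volume s := by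
  rw [Measure.addHaar_smul, finrank_euclideanSpace_fin, abs_of_nonneg (by positivity)]

theorem measure_frontier_smul_set {c : ℝ} (hc : 0 < c) (s : Set (EuclideanSpace ℝ (Fin n)))
    (d : ℕ) : μHE[d] (frontier (c • s)) = ENNReal.ofReal (c ^ d) * μHE[d] (frontier s) := by
  rw [frontier_smul₀ hc.ne', Measure.euclideanHausdorffMeasure_smul₀ _ hc.ne', ENNReal.smul_def,
    smul_eq_mul, ENNReal.ofReal_pow hc.le, ENNReal.coe_pow, Real.nnnorm_of_nonneg hc.le,
    ENNReal.ofReal, Real.toNNReal_of_nonneg hc.le]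

theorem ofReal_mul_measure_frontier_le_of_center_zero (hn : 1 ≤ n)
    {Ω : Set (EuclideanSpace ℝ (Fin n))}
    (hΩ : IsConvexBody Ω) {r : ℝ} (hr : 0 < r) (hball : Metric.closedBall 0 r ⊆ Ω) :
    ENNReal.ofReal r * μHE[n - 1] (frontier Ω) ≤ n * volume Ω := by
  have h0 : 0 ∈ interior Ω :=
    mem_interior_iff_mem_nhds.2 (mem_of_superset (Metric.closedBall_mem_nhds 0 hr) hball)
  refine le_of_forall_le_ofReal_pow_mul n fun c hc => ?_
  have hc0 : 0 < c := one_pos.trans hc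
  obtain ⟨t, a, b, ha, hsub, hsup⟩ := exists_polytope_between hΩ h0 hc
  have hb i : r ≤ b i := by
    have h := hsub (hball (show r • a i ∈ Metric.closedBall 0 r by
      rw [mem_closedBall_zero_iff, norm_smul, ha, mul_one, Real.norm_of_nonneg hr.le])) i
    rwa [inner_smul_right, real_inner_self_eq_norm_sq, ha, one_pow, mul_one] at h
  calc ENNReal.ofReal r * μHE[n - 1] (frontier Ω)
      ≤ ENNReal.ofReal r * μHE[n - 1] (frontier (polytope a b)) := by
        gcongr ENNReal.ofReal r * ?_
        exact measure_frontier_mono hΩ.convex hΩ.nonempty_interior hsub isClosed_polytope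
          ((hΩ.isCompact.smul c).isBounded.subset hsup) _
    _ ≤ n * volume (polytope a b) := ofReal_mul_measure_frontier_polytope_le hn ha hr hb
    _ ≤ n * volume (c • Ω) := by gcongr
    _ = ENNReal.ofReal (c ^ n) * (n * volume Ω) := by rw [volume_smul_set hc0]; ring

theorem volume_le_of_zero_mem_interior (hn : 1 ≤ n) {Ω : Set (EuclideanSpace ℝ (Fin n))}
    (hΩ : IsConvexBody Ω) (h0 : 0 ∈ interior Ω) {R : ℝ}
    (hR : ∀ x s, 0 ≤ s → Metric.closedBall x s ⊆ Ω → s ≤ R) :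
    volume Ω ≤ ENNReal.ofReal R * μHE[n - 1] (frontier Ω) := by
  have : Nonempty (Fin n) := ⟨⟨0, hn⟩⟩
  refine le_of_forall_le_ofReal_pow_mul n fun c hc => ?_
  have hc0 : 0 < c := one_pos.trans hc
  obtain ⟨t, a, b, ha, hsub, hsup⟩ := exists_polytope_between hΩ h0 hc
  have hcpt : IsCompact (c • Ω) := hΩ.isCompact.smul c
  have : Nonempty t := by
    by_contra hemp
    rw [not_nonempty_iff] at hemp
    have huniv : polytope a b = Set.univ := Set.eq_univ_of_forall fun x i => isEmptyElim i
    rw [huniv, Set.univ_subset_iff] at hsup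
    exact noncompact_univ _ (hsup ▸ hcpt)
  have hball : ∀ x s, 0 ≤ s → Metric.closedBall x s ⊆ polytope a b → s ≤ c * R := by
    intro x s hs h
    have h1 : Metric.closedBall (c⁻¹ • x) (c⁻¹ * s) ⊆ Ω := by
      have h2 := Set.smul_set_mono (a := c⁻¹) (h.trans hsup)
      rwa [inv_smul_smul₀ hc0.ne', smul_closedBall _ _ hs,
        Real.norm_of_nonneg (inv_pos.2 hc0).le] at h2
    have h3 := hR _ _ (by positivity) h1
    rwa [inv_mul_le_iff₀ hc0] at h3
  calc volume Ω ≤ volume (polytope a b) := measure_mono hsub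
    _ ≤ ENNReal.ofReal (c * R) * μHE[n - 1] (frontier (polytope a b)) :=
        volume_polytope_le_of_inscribed_le ha hball
    _ ≤ ENNReal.ofReal (c * R) * μHE[n - 1] (frontier (c • Ω)) := by
        gcongr ENNReal.ofReal (c * R) * ?_
        exact measure_frontier_mono convex_polytope
          (hΩ.nonempty_interior.mono (interior_mono hsub)) hsup hcpt.isClosed hcpt.isBounded _
    -- The perimeter scales by c ^ (n - 1), and the bound on the inradius contributes the remaining
    -- factor c.
    _ = ENNReal.ofReal (c ^ n) * (ENNReal.ofReal R * μHE[n - 1] (frontier Ω)) := by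
        rw [measure_frontier_smul_set hc0, ENNReal.ofReal_mul hc0.le,
          show c ^ n = c ^ (n - 1) * c by rw [← pow_succ, Nat.sub_add_cancel hn],
          ENNReal.ofReal_mul (p := c ^ (n - 1)) (by positivity)]
        ring

/-! ### Translation, existence of the inradius, and the general inequalities. -/

theorem IsConvexBody.preimage_add_right {Ω : Set (EuclideanSpace ℝ (Fin n))}
    (hΩ : IsConvexBody Ω) (v : EuclideanSpace ℝ (Fin n)) :
    IsConvexBody ((fun x => x + v) ⁻¹' Ω) where
  convex := hΩ.convex.translate_preimage_left v
  isCompact := (Homeomorph.addRight v).isCompact_preimage.2 hΩ.isCompact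
  nonempty_interior := by
    have h := (Homeomorph.addRight v).preimage_interior Ω
    rw [Homeomorph.coe_addRight] at h
    rw [← h]
    exact hΩ.nonempty_interior.preimage (Homeomorph.addRight v).surjective

theorem measure_frontier_preimage_add_right (Ω : Set (EuclideanSpace ℝ (Fin n)))
    (v : EuclideanSpace ℝ (Fin n)) (d : ℕ) :
    μHE[d] (frontier ((fun x => x + v) ⁻¹' Ω)) = μHE[d] (frontier Ω) := by
  have h := (Homeomorph.addRight v).preimage_frontier Ω
  rw [Homeomorph.coe_addRight] at h
  rw [← h, measure_preimage_add_right]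

theorem closedBall_subset_preimage_add_right {Ω : Set (EuclideanSpace ℝ (Fin n))}
    {v x : EuclideanSpace ℝ (Fin n)} {s : ℝ} :
    Metric.closedBall x s ⊆ (fun x => x + v) ⁻¹' Ω ↔ Metric.closedBall (x + v) s ⊆ Ω := by
  rw [← Set.image_subset_iff]
  have h : (fun x => x + v) '' Metric.closedBall x s = Metric.closedBall (x + v) s :=
    (IsometryEquiv.addRight v).image_closedBall x s
  rw [h]

theorem ofReal_mul_measure_frontier_le (hn : 1 ≤ n) {Ω : Set (EuclideanSpace ℝ (Fin n))}
    (hΩ : IsConvexBody Ω) {x : EuclideanSpace ℝ (Fin n)} {r : ℝ} (hr : 0 < r)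
    (hball : Metric.closedBall x r ⊆ Ω) :
    ENNReal.ofReal r * μHE[n - 1] (frontier Ω) ≤ n * volume Ω := by
  have h := ofReal_mul_measure_frontier_le_of_center_zero hn (hΩ.preimage_add_right x) hr
    (closedBall_subset_preimage_add_right.2 (by rwa [zero_add]))
  rwa [measure_frontier_preimage_add_right, measure_preimage_add_right] at h

theorem volume_le_ofReal_mul_measure_frontier (hn : 1 ≤ n) {Ω : Set (EuclideanSpace ℝ (Fin n))}
    (hΩ : IsConvexBody Ω) {R : ℝ} (hR : ∀ x s, 0 ≤ s → Metric.closedBall x s ⊆ Ω → s ≤ R) :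
    volume Ω ≤ ENNReal.ofReal R * μHE[n - 1] (frontier Ω) := by
  obtain ⟨v, hv⟩ := hΩ.nonempty_interior
  have h0 : 0 ∈ interior ((fun x => x + v) ⁻¹' Ω) := by
    have h := (Homeomorph.addRight v).preimage_interior Ω
    rw [Homeomorph.coe_addRight] at h
    rw [← h]
    simpa using hv
  have h := volume_le_of_zero_mem_interior hn (hΩ.preimage_add_right v) h0 (R := R)
    fun x s hs hx => hR _ s hs (closedBall_subset_preimage_add_right.1 hx)
  rwa [measure_frontier_preimage_add_right, measure_preimage_add_right] at h

/-- The distance to the complement is continuous, so it attains a maximum on Ω; the maximum is the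
largest inscribed radius. -/
theorem exists_isGreatest_inscribedRadii (hn : 1 ≤ n) {Ω : Set (EuclideanSpace ℝ (Fin n))}
    (hΩ : IsConvexBody Ω) : ∃ R, 0 < R ∧ IsGreatest (inscribedRadii Ω) R := by
  have : Nonempty (Fin n) := ⟨⟨0, hn⟩⟩
  have hcne : (Ωᶜ).Nonempty := Set.nonempty_compl.2 hΩ.isCompact.ne_univ
  obtain ⟨x, hx, hmax⟩ := hΩ.isCompact.exists_isMaxOn (hΩ.nonempty_interior.mono interior_subset)
    (Metric.continuous_infDist_pt (Ωᶜ)).continuousOn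
  have hub : ∀ y s, 0 ≤ s → Metric.closedBall y s ⊆ Ω → s ≤ Metric.infDist x Ωᶜ := by
    intro y s hs hy
    refine le_trans ?_ (hmax (hy (Metric.mem_closedBall_self hs)))
    refine (Metric.le_infDist hcne).2 fun z hz => ?_
    by_contra! hlt
    exact hz (hy (Metric.mem_closedBall'.2 hlt.le))
  have hpos : 0 < Metric.infDist x Ωᶜ := by
    obtain ⟨y, hy⟩ := hΩ.nonempty_interior
    obtain ⟨ε, hε, hball⟩ := Metric.nhds_basis_closedBall.mem_iff.1
      (mem_interior_iff_mem_nhds.1 hy)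
    exact hε.trans_le (hub y ε hε.le hball)
  refine ⟨_, hpos, ⟨hpos.le, x, ?_⟩, fun s hs => ?_⟩
  · rw [← closure_ball x hpos.ne']
    refine closure_minimal ?_ hΩ.isCompact.isClosed
    simpa using Metric.ball_infDist_compl_subset (s := Ω) (x := x)
  · obtain ⟨hs0, y, hy⟩ := hs
    exact hub y s hs0 hy

theorem isGreatest_inradius (hn : 1 ≤ n) {Ω : Set (EuclideanSpace ℝ (Fin n))}
    (hΩ : IsConvexBody Ω) : IsGreatest (inscribedRadii Ω) (inradius Ω) := by
  obtain ⟨R, -, hR⟩ := exists_isGreatest_inscribedRadii hn hΩ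
  rwa [inradius, hR.csSup_eq]

theorem inradius_pos (hn : 1 ≤ n) {Ω : Set (EuclideanSpace ℝ (Fin n))}
    (hΩ : IsConvexBody Ω) : 0 < inradius Ω := by
  obtain ⟨R, hpos, hR⟩ := exists_isGreatest_inscribedRadii hn hΩ
  rwa [inradius, hR.csSup_eq]

theorem IsConvexBody.volume_pos {Ω : Set (EuclideanSpace ℝ (Fin n))} (hΩ : IsConvexBody Ω) :
    0 < volume Ω :=
  (isOpen_interior.measure_pos volume hΩ.nonempty_interior).trans_le
    (measure_mono interior_subset)

/-- Finiteness comes from r·per ≤ n·vol < ∞ with r > 0; positivity, below, comes from 0 < vol ≤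
R·per. -/
theorem IsConvexBody.measure_frontier_lt_top (hn : 1 ≤ n) {Ω : Set (EuclideanSpace ℝ (Fin n))}
    (hΩ : IsConvexBody Ω) : μHE[n - 1] (frontier Ω) < ⊤ := by
  obtain ⟨x, hx⟩ := (isGreatest_inradius hn hΩ).1.2
  have h := (ofReal_mul_measure_frontier_le hn hΩ (inradius_pos hn hΩ) hx).trans_lt
    (ENNReal.mul_lt_top (ENNReal.natCast_lt_top n) hΩ.isCompact.measure_lt_top)
  exact ENNReal.lt_top_of_mul_ne_top_right h.ne
    (ENNReal.ofReal_pos.2 (inradius_pos hn hΩ)).ne'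

theorem IsConvexBody.measure_frontier_pos (hn : 1 ≤ n) {Ω : Set (EuclideanSpace ℝ (Fin n))}
    (hΩ : IsConvexBody Ω) : 0 < μHE[n - 1] (frontier Ω) := by
  have h := hΩ.volume_pos.trans_le (volume_le_ofReal_mul_measure_frontier hn hΩ
    fun x s hs hx => (isGreatest_inradius hn hΩ).2 ⟨hs, x, hx⟩)
  exact pos_iff_ne_zero.2 fun h0 => by simp [h0] at h

theorem IsConvexBody.vol_pos {Ω : Set (EuclideanSpace ℝ (Fin n))} (hΩ : IsConvexBody Ω) :
    0 < vol Ω :=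
  ENNReal.toReal_pos hΩ.volume_pos.ne' hΩ.isCompact.measure_lt_top.ne

theorem IsConvexBody.per_pos (hn : 1 ≤ n) {Ω : Set (EuclideanSpace ℝ (Fin n))}
    (hΩ : IsConvexBody Ω) : 0 < per Ω :=
  ENNReal.toReal_pos (hΩ.measure_frontier_pos hn).ne' (hΩ.measure_frontier_lt_top hn).ne

theorem vol_div_per_le_inradius (hn : 1 ≤ n) {Ω : Set (EuclideanSpace ℝ (Fin n))}
    (hΩ : IsConvexBody Ω) : vol Ω / per Ω ≤ inradius Ω := by
  have h := volume_le_ofReal_mul_measure_frontier hn hΩ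
    fun x s hs hx => (isGreatest_inradius hn hΩ).2 ⟨hs, x, hx⟩
  have h' := ENNReal.toReal_mono
    (ENNReal.mul_ne_top ENNReal.ofReal_ne_top (hΩ.measure_frontier_lt_top hn).ne) h
  rw [ENNReal.toReal_mul, ENNReal.toReal_ofReal (inradius_pos hn hΩ).le] at h'
  rwa [div_le_iff₀ (hΩ.per_pos hn)]

theorem inradius_le_mul_vol_div_per (hn : 1 ≤ n) {Ω : Set (EuclideanSpace ℝ (Fin n))}
    (hΩ : IsConvexBody Ω) : inradius Ω ≤ n * (vol Ω / per Ω) := by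
  obtain ⟨x, hx⟩ := (isGreatest_inradius hn hΩ).1.2
  have h := ofReal_mul_measure_frontier_le hn hΩ (inradius_pos hn hΩ) hx
  have h' := ENNReal.toReal_mono
    (ENNReal.mul_ne_top (ENNReal.natCast_ne_top n) hΩ.isCompact.measure_lt_top.ne) h
  rw [ENNReal.toReal_mul, ENNReal.toReal_mul, ENNReal.toReal_ofReal (inradius_pos hn hΩ).le,
    ENNReal.toReal_natCast] at h'
  rwa [← mul_div_assoc, le_div_iff₀ (hΩ.per_pos hn)]

/-! ### Boxes and sharpness. -/

/-- The side lengths of the box `[0,1] × [0,K]ⁿ⁻¹`. -/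
def side (n : ℕ) (K : ℝ) (i : Fin n) : ℝ := if (i : ℕ) = 0 then 1 else K

theorem one_le_side {K : ℝ} (hK : 1 ≤ K) (i : Fin n) : 1 ≤ side n K i := by
  rw [side]; split_ifs <;> linarith

theorem mem_box {K : ℝ} {x : EuclideanSpace ℝ (Fin n)} :
    x ∈ box n K ↔ ∀ i, 0 ≤ x i ∧ x i ≤ side n K i := Iff.rfl

/-- The point of `ℝⁿ` all of whose coordinates are `1/2`. -/
noncomputable def halfPoint (n : ℕ) : EuclideanSpace ℝ (Fin n) := WithLp.toLp 2 fun _ => 1 / 2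

theorem halfPoint_apply (i : Fin n) : halfPoint n i = 1 / 2 := rfl

theorem closedBall_subset_box {K : ℝ} (hK : 1 ≤ K) :
    Metric.closedBall (halfPoint n) (1 / 2) ⊆ box n K := by
  intro x hx
  rw [mem_box]
  intro i
  rw [mem_closedBall_iff_norm] at hx
  have h := (PiLp.norm_apply_le (x - halfPoint n) i).trans hx
  rw [PiLp.sub_apply, halfPoint_apply, Real.norm_eq_abs, abs_le] at h
  have := one_le_side hK i
  constructor <;> linarith [h.1, h.2]

theorem isConvexBody_box {K : ℝ} (hK : 1 ≤ K) : IsConvexBody (box n K) where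
  convex := by
    intro x hx y hy s t hs ht hst i
    exact convex_Icc _ _ (hx i) (hy i) hs ht hst
  isCompact := by
    have h := (EuclideanSpace.equiv (Fin n) ℝ).toHomeomorph.isCompact_preimage.2
      (isCompact_univ_pi fun i => isCompact_Icc (a := 0) (b := side n K i))
    convert h using 1
    ext x
    rw [mem_box, Set.mem_preimage, Set.mem_univ_pi]
    rfl
  nonempty_interior := ⟨halfPoint n, mem_interior_iff_mem_nhds.2
    (mem_of_superset (Metric.closedBall_mem_nhds _ (by norm_num)) (closedBall_subset_box hK))⟩

theorem inradius_box (hn : 1 ≤ n) {K : ℝ} (hK : 1 ≤ K) : inradius (box n K) = 1 / 2 := by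
  have hg := isGreatest_inradius hn (isConvexBody_box (n := n) hK)
  refine le_antisymm ?_ (hg.2 ⟨by norm_num, _, closedBall_subset_box hK⟩)
  obtain ⟨hs, x, hx⟩ := hg.1
  set s := inradius (box n K)
  set i₀ : Fin n := ⟨0, hn⟩
  -- Moving from the centre by s in both directions along the first axis stays in an interval of
  -- length 1, so 2s ≤ 1.
  have hmem (t : ℝ) (ht : |t| ≤ s) : x i₀ + t ∈ Set.Icc (0 : ℝ) 1 := by
    have h : x + t • EuclideanSpace.single i₀ (1 : ℝ) ∈ box n K := by
      apply hx
      rw [mem_closedBall_iff_norm, add_sub_cancel_left, norm_smul]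
      simpa using ht
    simpa [side, i₀] using mem_box.1 h i₀
  have h1 := (hmem s (abs_of_nonneg hs).le).2
  have h2 := (hmem (-s) (by rw [abs_neg, abs_of_nonneg hs])).1
  linarith

theorem inner_single_one (i : Fin n) (x : EuclideanSpace ℝ (Fin n)) :
    ⟪EuclideanSpace.single i (1 : ℝ), x⟫ = x i := by
  simp [EuclideanSpace.inner_single_left]

theorem frontier_box_subset {K : ℝ} (hK : 1 ≤ K) : frontier (box n K) ⊆
    ⋃ i, ({x | x ∈ box n K ∧ x i = side n K i} ∪ {x | x ∈ box n K ∧ x i = 0}) := by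
  rw [(isConvexBody_box hK).isCompact.isClosed.frontier_eq]
  rintro x ⟨hx, hxi⟩
  by_contra hne
  simp only [Set.mem_iUnion, Set.mem_union, not_exists, not_or] at hne
  refine hxi (mem_interior.2 ⟨{y | ∀ i, 0 < y i ∧ y i < side n K i},
    fun y hy i => ⟨(hy i).1.le, (hy i).2.le⟩, ?_, fun i => ?_⟩)
  · simp only [Set.ofPred_forall, Set.ofPred_and]
    exact isOpen_iInter_of_finite fun i => (isOpen_lt (by fun_prop) (by fun_prop)).inter
      (isOpen_lt (by fun_prop) (by fun_prop))
  · have h := mem_box.1 hx i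
    exact ⟨h.1.lt_of_ne fun h0 => (hne i).2 ⟨hx, h0.symm⟩,
      h.2.lt_of_ne fun h1 => (hne i).1 ⟨hx, h1⟩⟩

/-- The box is the slab over either of its faces orthogonal to axis i, with depth the i-th side. -/
theorem ofReal_side_mul_measure_box_facet {K : ℝ} (hK : 1 ≤ K) (i : Fin n) (c : ℝ)
    (hc : c = side n K i ∨ c = 0) :
    ENNReal.ofReal (side n K i) * μHE[n - 1] {x | x ∈ box n K ∧ x i = c} =
      volume (box n K) := by
  have hm : MeasurableSet {x | x ∈ box n K ∧ x i = c} :=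
    (isConvexBody_box hK).isCompact.measurableSet.inter
      (isClosed_eq (by fun_prop) (by fun_prop)).measurableSet
  have hside := one_le_side hK i
  have hadd (x : EuclideanSpace ℝ (Fin n)) :
      x + (c - x i) • EuclideanSpace.single i (1 : ℝ) ∈ {x | x ∈ box n K ∧ x i = c} ↔
        ∀ j, j ≠ i → 0 ≤ x j ∧ x j ≤ side n K j := by
    change _ ∧ _ ↔ _
    rw [mem_box]
    constructor
    · rintro ⟨h, -⟩ j hj
      simpa [hj] using h j
    · intro h
      refine ⟨fun j => ?_, by simp⟩
      by_cases hj : j = i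
      · subst hj
        rcases hc with rfl | rfl <;> simp <;> linarith
      · simpa [hj] using h j hj
  have hbox (x : EuclideanSpace ℝ (Fin n)) : x ∈ box n K ↔
      (0 ≤ x i ∧ x i ≤ side n K i) ∧ ∀ j, j ≠ i → 0 ≤ x j ∧ x j ≤ side n K j := by
    rw [mem_box]
    exact ⟨fun h => ⟨h i, fun j _ => h j⟩,
      fun h j => if hj : j = i then hj ▸ h.1 else h.2 j hj⟩
  rcases hc with rfl | rfl
  · rw [← volume_slab (a := EuclideanSpace.single i 1) (by simp) (side n K i) (side n K i) hm
      fun x hx => by rw [inner_single_one]; exact hx.2]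
    congr 1
    ext x
    rw [hbox, ← hadd]
    simp only [slab, Set.mem_ofPred_eq, inner_single_one, sub_self, and_assoc]
  · rw [← volume_slab (a := -EuclideanSpace.single i 1) (by simp) 0 (side n K i) hm
      fun x hx => by rw [inner_neg_left, inner_single_one, hx.2, neg_zero]]
    congr 1
    ext x
    rw [hbox, ← hadd]
    change (_ ∧ _ ∧ _) ↔ _
    rw [inner_neg_left, inner_single_one, sub_neg_eq_add, zero_add, smul_neg, ← neg_smul, ← and_assoc]
    refine and_congr ⟨fun h => ⟨?_, ?_⟩, fun h => ⟨?_, ?_⟩⟩ ?_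
    · linarith [h.2]
    · linarith [h.1]
    · linarith [h.2]
    · linarith [h.1]
    · rw [zero_sub]

/-- Subadditivity over the 2n faces. This upper bound suffices, the lower bound on the inradius
ratio being the general inequality. -/
theorem per_box_le {K : ℝ} (hK : 1 ≤ K) :
    per (box n K) ≤ 2 * vol (box n K) * ∑ i, (side n K i)⁻¹ := by
  have hfacet (i : Fin n) (c : ℝ) (hc : c = side n K i ∨ c = 0) :
      μHE[n - 1] {x | x ∈ box n K ∧ x i = c} =
        ENNReal.ofReal ((side n K i)⁻¹ * vol (box n K)) := by
    have hpos : 0 < side n K i := one_pos.trans_le (one_le_side hK i)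
    rw [ENNReal.ofReal_mul (by positivity), ENNReal.ofReal_inv_of_pos hpos, vol,
      ENNReal.ofReal_toReal (isConvexBody_box hK).isCompact.measure_lt_top.ne,
      ← ofReal_side_mul_measure_box_facet hK i c hc, ← mul_assoc,
      ENNReal.inv_mul_cancel (ENNReal.ofReal_pos.2 hpos).ne' ENNReal.ofReal_ne_top, one_mul]
  have hpos (i : Fin n) : 0 ≤ (side n K i)⁻¹ * vol (box n K) :=
    mul_nonneg (inv_nonneg.2 (zero_le_one.trans (one_le_side hK i))) ENNReal.toReal_nonneg
  have h : μHE[n - 1] (frontier (box n K)) ≤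
      ENNReal.ofReal (2 * vol (box n K) * ∑ i, (side n K i)⁻¹) := by
    calc μHE[n - 1] (frontier (box n K))
        ≤ ∑ i, (ENNReal.ofReal ((side n K i)⁻¹ * vol (box n K)) +
            ENNReal.ofReal ((side n K i)⁻¹ * vol (box n K))) := by
          refine (measure_mono (frontier_box_subset hK)).trans
            ((measure_iUnion_fintype_le _ _).trans (Finset.sum_le_sum fun i _ => ?_))
          rw [← hfacet i _ (Or.inl rfl)]
          nth_rw 2 [hfacet i _ (Or.inl rfl)]
          rw [← hfacet i _ (Or.inr rfl)]
          exact measure_union_le _ _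
      _ = ENNReal.ofReal (2 * vol (box n K) * ∑ i, (side n K i)⁻¹) := by
          rw [Finset.mul_sum, ENNReal.ofReal_sum_of_nonneg fun i _ => by
            rw [mul_assoc, mul_comm (vol _)]; exact mul_nonneg zero_le_two (hpos i)]
          refine Finset.sum_congr rfl fun i _ => ?_
          rw [← ENNReal.ofReal_add (hpos i) (hpos i)]
          congr 1
          ring
  refine ENNReal.toReal_le_of_le_ofReal ?_ h
  rw [mul_assoc, mul_comm (vol _), Finset.sum_mul]
  exact mul_nonneg zero_le_two (Finset.sum_nonneg fun i _ => hpos i)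

theorem preimage_add_halfPoint_cube : (fun x => x + halfPoint n) ⁻¹' box n 1 =
    polytope (Sum.elim (fun i : Fin n => EuclideanSpace.single i (1 : ℝ))
      fun i => -EuclideanSpace.single i (1 : ℝ)) fun _ => 1 / 2 := by
  ext x
  have hside (i : Fin n) : side n 1 i = 1 := by rw [side, ite_self]
  simp only [Set.mem_preimage, mem_box, polytope, Set.mem_ofPred_eq, Sum.forall, Sum.elim_inl,
    Sum.elim_inr, inner_neg_left, inner_single_one, PiLp.add_apply, halfPoint_apply, hside,
    ← forall_and]
  refine forall_congr' fun i => ⟨fun h => ⟨?_, ?_⟩, fun h => ⟨?_, ?_⟩⟩ <;> linarith [h.1, h.2]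

theorem inradius_cube (hn : 1 ≤ n) :
    inradius (box n 1) = n * (vol (box n 1) / per (box n 1)) := by
  have hbody := isConvexBody_box (n := n) le_rfl
  refine le_antisymm (inradius_le_mul_vol_div_per hn hbody) ?_
  have h := volume_polytope_le_of_offset_le (n := n)
    (a := Sum.elim (fun i : Fin n => EuclideanSpace.single i (1 : ℝ))
      fun i => -EuclideanSpace.single i (1 : ℝ)) (b := fun _ => 1 / 2) hn
    (by rintro (i | i) <;> simp) (fun _ => by norm_num) (fun x hx => ?_) (fun _ => le_rfl)
  · rw [← preimage_add_halfPoint_cube, measure_preimage_add_right,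
      measure_frontier_preimage_add_right] at h
    have h' := ENNReal.toReal_mono
      (ENNReal.mul_ne_top ENNReal.ofReal_ne_top (hbody.measure_frontier_lt_top hn).ne) h
    rw [ENNReal.toReal_mul, ENNReal.toReal_mul, ENNReal.toReal_ofReal (by norm_num),
      ENNReal.toReal_natCast] at h'
    rwa [inradius_box hn le_rfl, ← mul_div_assoc, div_le_iff₀ (hbody.per_pos hn)]
  · by_contra! hne
    refine hx ?_
    ext i
    have h1 := hne (Sum.inl i)
    have h2 := hne (Sum.inr i)
    simp only [Sum.elim_inl, Sum.elim_inr, inner_neg_left, inner_single_one] at h1 h2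
    rw [PiLp.zero_apply]
    linarith

theorem tendsto_inradius_box_div (hn : 1 ≤ n) :
    Tendsto (fun K : ℝ => inradius (box n K) / (vol (box n K) / per (box n K))) atTop (𝓝 1) := by
  -- Side 0 contributes 1, and each of the others contributes 1/K → 0.
  have hlim : Tendsto (fun K : ℝ => ∑ i, (side n K i)⁻¹) atTop (𝓝 1) := by
    have h : Tendsto (fun K : ℝ => ∑ i, (side n K i)⁻¹) atTop
        (𝓝 (∑ i : Fin n, if i = ⟨0, hn⟩ then 1 else 0)) := by
      refine tendsto_finsetSum _ fun i _ => ?_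
      by_cases hi : i = ⟨0, hn⟩
      · simp [side, hi]
      · have hi' : (i : ℕ) ≠ 0 := fun h => hi (Fin.ext h)
        simp only [side, hi, hi', if_false]
        exact tendsto_inv_atTop_zero
    rwa [Finset.sum_ite_eq' Finset.univ, if_pos (Finset.mem_univ _)] at h
  refine tendsto_of_tendsto_of_tendsto_of_le_of_le' tendsto_const_nhds hlim ?_ ?_
  all_goals
    filter_upwards [eventually_ge_atTop 1] with K hK
    have hbody := isConvexBody_box (n := n) hK
    have hv := hbody.vol_pos
    have hp := hbody.per_pos hn
  · rw [one_le_div (div_pos hv hp)]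
    exact vol_div_per_le_inradius hn hbody
  · rw [div_le_iff₀ (div_pos hv hp), inradius_box hn hK, ← mul_div_assoc, le_div_iff₀ hp]
    linarith [per_box_le (n := n) hK]

end Heron

end

theorem proposition1 (n : ℕ) (hn : 1 ≤ n) :
    -- the two inequalities (with all the quantities in them well defined)
    (∀ Ω : Set (EuclideanSpace ℝ (Fin n)), Heron.IsConvexBody Ω →
      (0 < volume Ω ∧ volume Ω < ⊤) ∧
      (0 < μHE[n - 1] (frontier Ω) ∧ μHE[n - 1] (frontier Ω) < ⊤) ∧
      IsGreatest (Heron.inscribedRadii Ω) (Heron.inradius Ω) ∧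
      Heron.vol Ω / Heron.per Ω ≤ Heron.inradius Ω ∧
      Heron.inradius Ω ≤ n * (Heron.vol Ω / Heron.per Ω)) ∧
    -- in each dimension, neither the constant `1` nor the constant `n` can be improved
    (∀ c : ℝ, (∀ Ω : Set (EuclideanSpace ℝ (Fin n)), Heron.IsConvexBody Ω →
      c * (Heron.vol Ω / Heron.per Ω) ≤ Heron.inradius Ω) → c ≤ 1) ∧
    (∀ C : ℝ, (∀ Ω : Set (EuclideanSpace ℝ (Fin n)), Heron.IsConvexBody Ω →
      Heron.inradius Ω ≤ C * (Heron.vol Ω / Heron.per Ω)) → (n : ℝ) ≤ C) ∧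
    -- the boxes `[0,1] × [0,K]ⁿ⁻¹` witness this
    (∀ K : ℝ, 1 ≤ K → Heron.IsConvexBody (Heron.box n K)) ∧
    Heron.inradius (Heron.box n 1) =
      n * (Heron.vol (Heron.box n 1) / Heron.per (Heron.box n 1)) ∧
    Tendsto (fun K : ℝ => Heron.inradius (Heron.box n K) /
      (Heron.vol (Heron.box n K) / Heron.per (Heron.box n K))) atTop (𝓝 1) := by
  refine ⟨fun Ω hΩ => ⟨⟨hΩ.volume_pos, hΩ.isCompact.measure_lt_top⟩,
    ⟨hΩ.measure_frontier_pos hn, hΩ.measure_frontier_lt_top hn⟩,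
    Heron.isGreatest_inradius hn hΩ, Heron.vol_div_per_le_inradius hn hΩ,
    Heron.inradius_le_mul_vol_div_per hn hΩ⟩, fun c hc => ?_, fun C hC => ?_,
    fun K hK => Heron.isConvexBody_box hK, Heron.inradius_cube hn,
    Heron.tendsto_inradius_box_div hn⟩
  · refine ge_of_tendsto (Heron.tendsto_inradius_box_div hn) ?_
    filter_upwards [eventually_ge_atTop 1] with K hK
    have hbody := Heron.isConvexBody_box (n := n) hK
    rw [le_div_iff₀ (div_pos hbody.vol_pos (hbody.per_pos hn))]
    exact hc _ hbody
  · have hbody := Heron.isConvexBody_box (n := n) le_rfl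
    have h := hC _ hbody
    rw [Heron.inradius_cube hn] at h
    exact le_of_mul_le_mul_right h (div_pos hbody.vol_pos (hbody.per_pos hn))
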